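/- Let $X\subset\mathbb R^d$ be closed and convex, $\varphi:\mathbb R^d\to\mathbb R$ convex, $P$ a probability measure on a measurable space $\mathcal S$, and $f(\cdot\,;\cdot):\mathbb R^d\times\mathcal S\to\mathbb R$ a function such that $f(x;\cdot)$ is measurable for every $x\in\mathbb R^d$ and $P$-integrable for every $x\in X$. Assume that for every $x\in X$ there are $\varepsilon>0$ and functions $M,\lambda:\mathcal S\to\mathbb R$ with $\int M^2\,dP<\infty$ and $\lambda\in L^1(P)$ such that, for $P$-almost every $s$, the function $f(\cdot\,;s)$ is $M(s)$-Lipschitz and $y\mapsto f(y;s)+\frac{\lambda(s)}2\|y-x\|^2$ is convex on the ball $\{y:\|y-x\|\le\varepsilon\}$. Put $f(x)=\int f(x;s)\,dP(s)$ and $G(x)=\partial f(x)+\partial\varphi(x)$, where $\partial f(x)=\{g: f(y)\ge f(x)+\langle g,y-x\rangle+o(\|y-x\|)\text{ as }y\to x\}$ is the Fréchet subdifferential and $\partial\varphi$ is the subdifferential of convex analysis. Let $\mathcal N_X(x)=\{v:\langle v,y-x\rangle\le 0\ \forall y\in X\}$ for $x\in X$ and $\mathcal N_X(x)=\emptyset$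 for $x\notin X$, and let $$\mathsf g^\star(x)=\operatorname{argmin}\{\|g\|^2: g\in\partial f(x)+\partial\varphi(x)+\mathcal N_X(x)\}.$$ Let $x:[0,\infty)\to\mathbb R^d$ be a solution of the differential inclusion $\dot x\in-G(x)-\mathcal N_X(x)$, that is, $x$ is absolutely continuous on every bounded interval and $\dot x(\tau)\in-G(x(\tau))-\mathcal N_X(x(\tau))$ for almost every $\tau\ge0$. If for some $t>0$ $$f(x(t))+\varphi(x(t))=f(x(0))+\varphi(x(0)),$$ then $\mathsf g^\star(x(\tau))=0$ for every $\tau\in[0,t]$; that is, the minimizer defining $\mathsf g^\star(x(\tau))$ exists and equals $0$. The same conclusion holds if, in the differential inclusion, $G$ is replaced by $x\mapsto\int_{\mathcal S}\partial f(x;s)\,dP(s)+\partial\varphi(x)$, where $\int_{\mathcal S}\partial f(x;s)\,dP(s)$ is the set of integrals of $P$-integrable functions $g$ with $g(s)\in\partial f(x;s)$ for almost every $s$ ($\partial f(x;s)$ being the Fréchet subdifferential of $f(\cdot\,;s)$ at $x$). -/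

import Mathlib

open MeasureTheory Filter Topology Set
open scoped Pointwise RealInnerProductSpace

namespace StochWeaklyConvex

section Subgradients

variable {E : Type*} [NormedAddCommGroup E] [InnerProductSpace ℝ E]

/-- The Fréchet subdifferential `∂h(x)`: all `g` with
`h y ≥ h x + ⟪g, y - x⟫ + o(‖y - x‖)` as `y → x`. -/
def frechetSubdifferential (h : E → ℝ) (x : E) : Set E :=
  {g | ∀ ε : ℝ, 0 < ε → ∀ᶠ y in 𝓝 x, h x + ⟪g, y - x⟫ - ε * ‖y - x‖ ≤ h y}

/-- The subdifferential of convex analysis: all `g` with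
`h y ≥ h x + ⟪g, y - x⟫` for every `y`. -/
def convexSubdifferential (h : E → ℝ) (x : E) : Set E :=
  {g | ∀ y, h x + ⟪g, y - x⟫ ≤ h y}

/-- The normal cone `N_X(x)` of a convex set `X`; it is empty when `x ∉ X`. -/
def normalCone (X : Set E) (x : E) : Set E :=
  {v | x ∈ X ∧ ∀ y ∈ X, ⟪v, y - x⟫ ≤ 0}

/-- `g = argmin {‖u‖² | u ∈ A}`, i.e. `g` is the projection of `0` onto `A`. -/
def IsMinimalNormElement (A : Set E) (g : E) : Prop :=
  g ∈ A ∧ IsMinOn (fun u => ‖u‖ ^ 2) A g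

end Subgradients

section Inclusions

variable {E : Type*} [NormedAddCommGroup E] [NormedSpace ℝ E]

/-- `x`, restricted to `[0, ∞)`, is a solution of the differential inclusion `ẋ ∈ H(x)`: it is
absolutely continuous on bounded intervals and satisfies the inclusion at almost every time. -/
structure IsInclusionSolution (H : E → Set E) (x : ℝ → E) : Prop where
  absolutelyContinuous : ∀ T : ℝ, 0 ≤ T → AbsolutelyContinuousOnInterval x 0 T
  inclusion : ∀ᵐ t ∂(volume.restrict (Ioi (0 : ℝ))), ∃ v ∈ H (x t), HasDerivAt x v t

variable {S : Type*} [MeasurableSpace S]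

/-- The set-valued integral `∫ A(s) dP(s)`: the integrals of all integrable selections of `A`. -/
def setIntegral (A : S → Set E) (P : Measure S) : Set E :=
  {u | ∃ g : S → E, Integrable g P ∧ (∀ᵐ s ∂P, g s ∈ A s) ∧ ∫ s, g s ∂P = u}

/-- The local Lipschitz assumption: near every `x ∈ X` the function `f(·; s)` is `M(s)`-Lipschitz
with `E[M(S)²] < ∞` (the radius `ε` and the function `M` may depend on `x`). -/
def LocallyLipschitzOn (X : Set E) (f : E → S → ℝ) (P : Measure S) : Prop :=
  ∀ x ∈ X, ∃ ε : ℝ, 0 < ε ∧ ∃ M : S → ℝ, MemLp M 2 P ∧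
    ∀ᵐ s ∂P, ∀ y ∈ Metric.closedBall x ε, ∀ z ∈ Metric.closedBall x ε,
      |f y s - f z s| ≤ M s * ‖y - z‖

/-- The local weak convexity assumption: near every `x ∈ X` the function
`y ↦ f(y; s) + (lam(s) / 2) ‖y - x‖²` is convex, with `E[lam(S)] < ∞` (the radius `ε` and the
function `lam` may depend on `x`). -/
def LocallyWeaklyConvexOn (X : Set E) (f : E → S → ℝ) (P : Measure S) : Prop :=
  ∀ x ∈ X, ∃ ε : ℝ, 0 < ε ∧ ∃ lam : S → ℝ, Integrable lam P ∧
    ∀ᵐ s ∂P, ConvexOn ℝ (Metric.closedBall x ε) (fun y => f y s + lam s / 2 * ‖y - x‖ ^ 2)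

/-- The expected function `f(x) = E[f(x; S)]`. -/
noncomputable def expected (f : E → S → ℝ) (P : Measure S) (x : E) : ℝ :=
  ∫ s, f x s ∂P

end Inclusions

section Composite

variable {E : Type*} [NormedAddCommGroup E] [InnerProductSpace ℝ E]
variable {S : Type*} [MeasurableSpace S]

/-- `G(x) = ∂f(x) + ∂φ(x)`, where `f(x) = E[f(x; S)]`. -/
noncomputable def subgradientMap (f : E → S → ℝ) (P : Measure S) (φ : E → ℝ) (x : E) : Set E :=
  frechetSubdifferential (expected f P) x + convexSubdifferential φ x

/-- `G(x) = ∫ ∂f(x; s) dP(s) + ∂φ(x)`. -/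
noncomputable def integralSubgradientMap (f : E → S → ℝ) (P : Measure S) (φ : E → ℝ) (x : E) :
    Set E :=
  setIntegral (fun s => frechetSubdifferential (fun y => f y s) x) P + convexSubdifferential φ x

/-- `g` is the minimal subgradient
`g⋆(x) = argmin {‖g‖² | g ∈ ∂f(x) + ∂φ(x) + N_X(x)}`. -/
def IsMinimalSubgradient (f : E → S → ℝ) (P : Measure S) (φ : E → ℝ) (X : Set E) (x g : E) :
    Prop :=
  IsMinimalNormElement (subgradientMap f P φ x + normalCone X x) g

end Composite

end StochWeaklyConvex

/-! Write `F = f + φ`. Wherever `x` and `F ∘ x` are both differentiable, any Fréchet subgradient `g`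
of `F` at `x` gives the derivative `⟪g, ẋ⟫` (`hasDerivAt_comp_eq_inner`): the subgradient inequality
can be tested both forwards and backwards in time. The normal component of the inclusion is
orthogonal to `ẋ`, since the curve stays in `X`; hence `(F ∘ x)' = -‖ẋ‖²` almost everywhere. `F ∘ x`
is absolutely continuous, so equal end values force `ẋ = 0` almost everywhere. Then `x` is constant
on `[0, t]`, and one time with zero velocity makes this single point stationary
(`IsInclusionSolution.zero_mem_of_eq`). The integral form of the inclusion reduces to the first by
`setIntegral_frechetSubdifferential_subset`. -/

namespace StochWeaklyConvex

/-! ### Fréchet subgradients: chain rule and quadratic bounds -/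

section Subgradients

variable {E : Type*} [NormedAddCommGroup E]

theorem isMinimalNormElement_zero {A : Set E} (h : (0 : E) ∈ A) : IsMinimalNormElement A 0 :=
  ⟨h, fun u _ => by simp⟩

variable [InnerProductSpace ℝ E]

theorem convexSubdifferential_subset_frechetSubdifferential (h : E → ℝ) (x : E) :
    convexSubdifferential h x ⊆ frechetSubdifferential h x := by
  intro g hg ε hε
  refine Eventually.of_forall fun y => ?_
  have := hg y
  have : 0 ≤ ε * ‖y - x‖ := by positivity
  linarith

theorem add_mem_frechetSubdifferential {h k : E → ℝ} {x u v : E}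
    (hu : u ∈ frechetSubdifferential h x) (hv : v ∈ frechetSubdifferential k x) :
    u + v ∈ frechetSubdifferential (fun y => h y + k y) x := by
  intro ε hε
  filter_upwards [hu (ε / 2) (by positivity), hv (ε / 2) (by positivity)] with y h1 h2
  rw [inner_add_left]
  linarith

/-- The derivative vanishes at a point where `0` is a Fréchet subgradient. -/
theorem hasDerivAt_eq_zero_of_eventually_le {ψ : ℝ → ℝ} {c τ : ℝ} (hψ : HasDerivAt ψ c τ)
    (hle : ∀ ε : ℝ, 0 < ε → ∀ᶠ s in 𝓝 τ, ψ τ - ε * |s - τ| ≤ ψ s) : c = 0 := by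
  by_contra hc
  have hc' : 0 < |c| := abs_pos.mpr hc
  have h1 := hψ.isLittleO.def (c := |c| / 4) (by positivity)
  obtain ⟨δ, hδ, hball⟩ := Metric.eventually_nhds_iff.mp (h1.and (hle (|c| / 4) (by positivity)))
  -- Moving downhill by `δ / 2`, `ψ` falls at rate at least `3|c|/4`, while the hypothesis allows at
  -- most `|c|/4`.
  rcases lt_or_gt_of_ne hc with hneg | hpos
  · have hs : τ + δ / 2 - τ = δ / 2 := by ring
    obtain ⟨h2, h3⟩ := @hball (τ + δ / 2) (by
      rw [Real.dist_eq, hs, abs_of_pos (by positivity)]; linarith)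
    rw [Real.norm_eq_abs, Real.norm_eq_abs, hs, abs_of_pos (half_pos hδ), abs_of_neg hneg,
      smul_eq_mul] at h2
    rw [hs, abs_of_pos (half_pos hδ), abs_of_neg hneg] at h3
    have := (abs_le.mp h2).2
    nlinarith
  · have hs : τ - δ / 2 - τ = -(δ / 2) := by ring
    obtain ⟨h2, h3⟩ := @hball (τ - δ / 2) (by
      rw [Real.dist_eq, hs, abs_neg, abs_of_pos (by positivity)]; linarith)
    rw [Real.norm_eq_abs, Real.norm_eq_abs, hs, abs_neg, abs_of_pos (half_pos hδ),
      abs_of_pos hpos, smul_eq_mul] at h2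
    rw [hs, abs_neg, abs_of_pos (half_pos hδ), abs_of_pos hpos] at h3
    have := (abs_le.mp h2).2
    nlinarith

/-- Chain rule for Fréchet subgradients along a differentiable curve. -/
theorem hasDerivAt_comp_eq_inner {F : E → ℝ} {x : ℝ → E} {τ r : ℝ} {g v : E}
    (hg : g ∈ frechetSubdifferential F (x τ)) (hx : HasDerivAt x v τ)
    (hF : HasDerivAt (fun s => F (x s)) r τ) : r = ⟪g, v⟫ := by
  have hinner : HasDerivAt (fun s => ⟪g, x s⟫) ⟪g, v⟫ τ := by
    simpa using (hasDerivAt_const τ g).inner ℝ hx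
  refine sub_eq_zero.mp (hasDerivAt_eq_zero_of_eventually_le (hF.sub hinner) fun ε hε => ?_)
  have hC : 0 < ‖v‖ + 1 := by positivity
  have h1 := hx.continuousAt.eventually (hg (ε / (‖v‖ + 1)) (by positivity))
  have h2 := hx.isLittleO.def (c := 1) one_pos
  filter_upwards [h1, h2] with s hs1 hs2
  have h3 : ‖x s - x τ‖ ≤ (‖v‖ + 1) * |s - τ| := by
    calc ‖x s - x τ‖ = ‖(x s - x τ - (s - τ) • v) + (s - τ) • v‖ := by rw [sub_add_cancel]
      _ ≤ ‖x s - x τ - (s - τ) • v‖ + ‖(s - τ) • v‖ := norm_add_le _ _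
      _ ≤ 1 * |s - τ| + |s - τ| * ‖v‖ := by
        rw [norm_smul, Real.norm_eq_abs]; exact add_le_add hs2 le_rfl
      _ = (‖v‖ + 1) * |s - τ| := by ring
  have h4 : ε / (‖v‖ + 1) * ‖x s - x τ‖ ≤ ε * |s - τ| := by
    calc ε / (‖v‖ + 1) * ‖x s - x τ‖ ≤ ε / (‖v‖ + 1) * ((‖v‖ + 1) * |s - τ|) := by gcongr
      _ = ε * |s - τ| := by field_simp
  rw [inner_sub_right] at hs1
  simp only [Pi.sub_apply]
  linarith

/-- A Fréchet subgradient of a weakly convex function satisfies a quadratic lower bound. -/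
theorem le_of_mem_frechetSubdifferential_of_convexOn {h : E → ℝ} {x g : E} {ε lam : ℝ}
    (hg : g ∈ frechetSubdifferential h x) (hε : 0 < ε)
    (hconv : ConvexOn ℝ (Metric.closedBall x ε) (fun y => h y + lam / 2 * ‖y - x‖ ^ 2))
    {y : E} (hy : y ∈ Metric.closedBall x ε) :
    h x + ⟪g, y - x⟫ - lam / 2 * ‖y - x‖ ^ 2 ≤ h y := by
  -- Compare the subgradient bound and convexity at `x + α • (y - x)`, divide by `α`, and let `α →
  -- 0⁺`; afterwards `η → 0⁺`. The sign of `lam` plays no role.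
  have key : ∀ η : ℝ, 0 < η →
      ⟪g, y - x⟫ - η * ‖y - x‖ ≤ h y - h x + lam / 2 * ‖y - x‖ ^ 2 := by
    intro η hη
    have hline : Tendsto (fun α : ℝ => x + α • (y - x)) (𝓝 0) (𝓝 x) := by
      have : Continuous fun α : ℝ => x + α • (y - x) := by fun_prop
      simpa using this.tendsto 0
    have hlim : Tendsto (fun α : ℝ => ⟪g, y - x⟫ - η * ‖y - x‖ + lam / 2 * α * ‖y - x‖ ^ 2)
        (𝓝[>] 0) (𝓝 (⟪g, y - x⟫ - η * ‖y - x‖)) := by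
      have : Continuous fun α : ℝ =>
          ⟪g, y - x⟫ - η * ‖y - x‖ + lam / 2 * α * ‖y - x‖ ^ 2 := by fun_prop
      simpa using (this.tendsto 0).mono_left nhdsWithin_le_nhds
    refine le_of_tendsto hlim ?_
    filter_upwards [(hline.eventually (hg η hη)).filter_mono nhdsWithin_le_nhds,
      Ioo_mem_nhdsGT (one_pos : (0 : ℝ) < 1)] with α h1 hα
    have hα0 : 0 < α := hα.1
    have h2 := hconv.2 (Metric.mem_closedBall_self hε.le) hy (sub_nonneg.mpr hα.2.le) hα0.le
      (by ring)
    have hpt : (1 - α) • x + α • y = x + α • (y - x) := by module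
    simp only [hpt, add_sub_cancel_left, sub_self, norm_zero, norm_smul, inner_smul_right,
      Real.norm_eq_abs, abs_of_pos hα0, smul_eq_mul] at h1 h2
    refine le_of_mul_le_mul_left ?_ hα0
    linarith
  have hlim : Tendsto (fun η : ℝ => ⟪g, y - x⟫ - η * ‖y - x‖) (𝓝[>] 0) (𝓝 ⟪g, y - x⟫) := by
    have : Continuous fun η : ℝ => ⟪g, y - x⟫ - η * ‖y - x‖ := by fun_prop
    simpa using (this.tendsto 0).mono_left nhdsWithin_le_nhds
  have := le_of_tendsto hlim (eventually_mem_nhdsWithin.mono fun η hη => key η hη)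
  linarith

/-- A quadratic lower bound near `x` yields a Fréchet subgradient. -/
theorem mem_frechetSubdifferential_of_quadratic {h : E → ℝ} {x g : E} {c : ℝ}
    (hle : ∀ᶠ y in 𝓝 x, h x + ⟪g, y - x⟫ - c * ‖y - x‖ ^ 2 ≤ h y) :
    g ∈ frechetSubdifferential h x := by
  intro ε hε
  have hsmall : ∀ᶠ y in 𝓝 x, c * ‖y - x‖ < ε := by
    have : Continuous fun y : E => c * ‖y - x‖ := by fun_prop
    exact (this.tendsto x).eventually_lt_const (by simpa using hε)
  filter_upwards [hle, hsmall] with y h1 h2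
  have := mul_le_mul_of_nonneg_right h2.le (norm_nonneg (y - x))
  nlinarith

end Subgradients

/-! ### Passing from `f(·; s)` to its expectation -/

section Expectation

variable {E : Type*} [NormedAddCommGroup E] {S : Type*} [MeasurableSpace S]

/-- Integrability at `x` extends to a ball on which the Lipschitz bound holds. -/
theorem integrable_of_lipschitz {P : Measure S} {f : E → S → ℝ} {x : E} {ε : ℝ} {M : S → ℝ}
    (hε : 0 < ε) (hmeas : ∀ y, AEStronglyMeasurable (f y) P) (hint : Integrable (f x) P)
    (hM : Integrable M P)
    (hlip : ∀ᵐ s ∂P, ∀ y ∈ Metric.closedBall x ε, ∀ z ∈ Metric.closedBall x ε,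
      |f y s - f z s| ≤ M s * ‖y - z‖)
    {y : E} (hy : y ∈ Metric.closedBall x ε) : Integrable (f y) P := by
  have hdiff : Integrable (fun s => f y s - f x s) P :=
    (hM.mul_const ‖y - x‖).mono' ((hmeas y).sub (hmeas x))
      (hlip.mono fun s hs => hs y hy x (Metric.mem_closedBall_self hε.le))
  refine (hdiff.add hint).congr (Eventually.of_forall fun s => ?_)
  simp

theorem locallyLipschitzOn_expected [NormedSpace ℝ E] {P : Measure S} [IsFiniteMeasure P] {X : Set E}
    {f : E → S → ℝ} (hmeas : ∀ y, AEStronglyMeasurable (f y) P)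
    (hint : ∀ y ∈ X, Integrable (f y) P) (hlip : LocallyLipschitzOn X f P) :
    _root_.LocallyLipschitzOn X (expected f P) := by
  intro x hx
  obtain ⟨ε, hε, M, hM2, hM⟩ := hlip x hx
  have hMi : Integrable M P := hM2.integrable (by norm_num)
  refine ⟨(∫ s, M s ∂P).toNNReal, Metric.closedBall x ε,
    mem_nhdsWithin_of_mem_nhds (Metric.closedBall_mem_nhds x hε),
    LipschitzOnWith.of_dist_le_mul fun y hy z hz => ?_⟩
  have hyi := integrable_of_lipschitz hε hmeas (hint x hx) hMi hM hy
  have hzi := integrable_of_lipschitz hε hmeas (hint x hx) hMi hM hz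
  calc dist (expected f P y) (expected f P z) = ‖∫ s, (f y s - f z s) ∂P‖ := by
        rw [integral_sub hyi hzi, Real.dist_eq, Real.norm_eq_abs]; rfl
    _ ≤ ∫ s, M s * ‖y - z‖ ∂P :=
        norm_integral_le_of_norm_le (hMi.mul_const _) (hM.mono fun s hs => hs y hy z hz)
    _ = (∫ s, M s ∂P) * ‖y - z‖ := integral_mul_const _ _
    _ ≤ (∫ s, M s ∂P).toNNReal * dist y z := by
        rw [dist_eq_norm]; gcongr; exact Real.le_coe_toNNReal _

/-- Integrals of subgradients are subgradients of the expected function. -/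
theorem setIntegral_frechetSubdifferential_subset [InnerProductSpace ℝ E] [CompleteSpace E]
    {P : Measure S} [IsFiniteMeasure P] {X : Set E} {f : E → S → ℝ}
    (hmeas : ∀ y, AEStronglyMeasurable (f y) P)
    (hint : ∀ y ∈ X, Integrable (f y) P) (hlip : LocallyLipschitzOn X f P)
    (hweak : LocallyWeaklyConvexOn X f P) {x : E} (hx : x ∈ X) :
    setIntegral (fun s => frechetSubdifferential (fun y => f y s) x) P ⊆
      frechetSubdifferential (expected f P) x := by
  rintro _ ⟨g, hgi, hg, rfl⟩
  obtain ⟨ε, hε, M, hM2, hM⟩ := hlip x hx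
  have hMi : Integrable M P := hM2.integrable (by norm_num)
  obtain ⟨δ, hδ, lam, hlam, hconv⟩ := hweak x hx
  -- The Fréchet remainder need not be uniform in `s`. Weak convexity replaces it by `lam s / 2 * ‖y
  -- - x‖ ^ 2` on a ball independent of `s`, which integrates to this constant.
  refine mem_frechetSubdifferential_of_quadratic (c := (∫ s, lam s ∂P) / 2) ?_
  filter_upwards [Metric.closedBall_mem_nhds x hε, Metric.closedBall_mem_nhds x hδ] with y hy hy'
  have hyi := integrable_of_lipschitz hε hmeas (hint x hx) hMi hM hy
  have hinner : Integrable (fun s => ⟪g s, y - x⟫) P := hgi.inner_const (y - x)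
  have hquad : Integrable (fun s => lam s / 2 * ‖y - x‖ ^ 2) P :=
    (hlam.div_const 2).mul_const _
  have hle : ∫ s, (f x s + ⟪g s, y - x⟫ - lam s / 2 * ‖y - x‖ ^ 2) ∂P ≤ ∫ s, f y s ∂P := by
    refine integral_mono_ae (((hint x hx).add hinner).sub hquad) hyi ?_
    filter_upwards [hg, hconv] with s h1 h2
    exact le_of_mem_frechetSubdifferential_of_convexOn h1 hδ h2 hy'
  have hval : ∫ s, ⟪g s, y - x⟫ ∂P = ⟪∫ s, g s ∂P, y - x⟫ := by
    rw [real_inner_comm, ← integral_inner hgi]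
    simp only [real_inner_comm]
  have e1 := integral_sub ((hint x hx).add hinner) hquad
  have e2 := integral_add (hint x hx) hinner
  simp only [Pi.add_apply] at e1
  rw [e1, e2, hval, integral_mul_const, integral_div] at hle
  exact hle

end Expectation

/-! ### Energy identity along solutions -/

section Flow

variable {E : Type*} [NormedAddCommGroup E]

theorem _root_.LipschitzOnWith.comp_absolutelyContinuousOnInterval {α β : Type*}
    [PseudoMetricSpace α] [PseudoMetricSpace β] {K : NNReal} {F : α → β} {x : ℝ → α} {a b : ℝ}
    (hF : LipschitzOnWith K F (x '' uIcc a b)) (hx : AbsolutelyContinuousOnInterval x a b) :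
    AbsolutelyContinuousOnInterval (fun s => F (x s)) a b := by
  rw [absolutelyContinuousOnInterval_iff] at hx ⊢
  intro ε hε
  -- `K + 1` rather than `K`, which may vanish.
  obtain ⟨δ, hδ, h⟩ := hx (ε / (K + 1)) (by positivity)
  refine ⟨δ, hδ, fun I hI hlen => ?_⟩
  have hlt := h I hI hlen
  rw [lt_div_iff₀ (by positivity)] at hlt
  refine lt_of_le_of_lt ?_ hlt
  rw [Finset.sum_mul]
  refine Finset.sum_le_sum fun i hi => ?_
  have h1 := hF.dist_le_mul _ (mem_image_of_mem x (hI.1 i hi).1) _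
    (mem_image_of_mem x (hI.1 i hi).2)
  have h2 : 0 ≤ dist (x (I.2 i).1) (x (I.2 i).2) := dist_nonneg
  linarith

/-- Outside the closed set the curve would stay outside for a time interval of positive length to
the right of `τ`, where `H` is empty, against the inclusion. Using the right side covers `τ = 0`. -/
theorem IsInclusionSolution.mem_of_isClosed [NormedSpace ℝ E] {H : E → Set E} {x : ℝ → E}
    {X : Set E} (hx : IsInclusionSolution H x) (hX : IsClosed X)
    (hH : ∀ z, (H z).Nonempty → z ∈ X) {τ : ℝ} (hτ : 0 ≤ τ) : x τ ∈ X := by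
  by_contra hmem
  have hcont := (hx.absolutelyContinuous (τ + 1) (by linarith)).continuousOn
  rw [uIcc_of_le (by linarith)] at hcont
  have h1 : ∀ᶠ s in 𝓝[>] τ, x s ∈ Xᶜ := by
    have h2 := (hcont τ ⟨hτ, by linarith⟩).eventually (hX.isOpen_compl.mem_nhds hmem)
    refine h2.filter_mono (nhdsWithin_le_of_mem ?_)
    filter_upwards [Ioo_mem_nhdsGT (show τ < τ + 1 by linarith)] with s hs
    exact ⟨hτ.trans hs.1.le, hs.2.le⟩
  obtain ⟨u, hu, hsub⟩ := mem_nhdsGT_iff_exists_Ioo_subset.mp h1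
  have hae := (ae_restrict_iff' measurableSet_Ioi).mp hx.inclusion
  have h0 : volume (Ioo τ u) = 0 := by
    refine measure_mono_null (t := {s | ¬(s ∈ Ioi 0 → ∃ v ∈ H (x s), HasDerivAt x v s)})
      (fun s hs => mem_ofPred.mpr fun hsH => ?_) (ae_iff.mp hae)
    obtain ⟨v, hv, -⟩ := hsH (hτ.trans_lt hs.1)
    exact hsub hs (hH _ ⟨v, hv⟩)
  rw [Real.volume_Ioo, ENNReal.ofReal_eq_zero] at h0
  exact absurd hu (by simp only [mem_Ioi, not_lt]; linarith)

variable [InnerProductSpace ℝ E]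

/-- If `F` takes the same value at both ends of `[0, t]` along a solution of `ẋ ∈ -A(x) - N_X(x)`,
`A` being made of Fréchet subgradients of `F`, then every `x τ` on `[0, t]` is stationary. -/
theorem IsInclusionSolution.zero_mem_of_eq {F : E → ℝ} {A : E → Set E} {X : Set E} {x : ℝ → E}
    (hx : IsInclusionSolution (fun z => -A z - normalCone X z) x) (hX : IsClosed X)
    (hF : _root_.LocallyLipschitzOn X F) (hA : ∀ z ∈ X, A z ⊆ frechetSubdifferential F z)
    {t : ℝ} (ht : 0 < t) (hFt : F (x t) = F (x 0)) {τ : ℝ} (hτ : τ ∈ Icc 0 t) :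
    0 ∈ A (x τ) + normalCone X (x τ) := by
  have hmem : ∀ s, 0 ≤ s → x s ∈ X := fun s hs => hx.mem_of_isClosed hX
    (by rintro z ⟨_, _, _, n, hn, _⟩; exact hn.1) hs
  have hxac := hx.absolutelyContinuous t ht.le
  have himg : x '' uIcc 0 t ⊆ X := by
    rintro _ ⟨s, hs, rfl⟩
    rw [uIcc_of_le ht.le] at hs
    exact hmem s hs.1
  obtain ⟨K, hK⟩ := (hF.mono himg).exists_lipschitzOnWith_of_compact
    (isCompact_uIcc.image_of_continuousOn hxac.continuousOn)
  have hFac := hK.comp_absolutelyContinuousOnInterval hxac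
  have hincl := (ae_restrict_iff' measurableSet_Ioi).mp hx.inclusion
  have hderiv : ∀ᵐ s, s ∈ Ioc 0 t → ∃ v ∈ -A (x s) - normalCone X (x s),
      HasDerivAt x v s ∧ deriv (fun r => F (x r)) s = -‖v‖ ^ 2 := by
    filter_upwards [hincl, hFac.ae_differentiableAt] with s h1 h2 hs
    obtain ⟨v, hv, hxv⟩ := h1 hs.1
    refine ⟨v, hv, hxv, ?_⟩
    have hFd := (h2 (by rw [uIcc_of_le ht.le]; exact ⟨hs.1.le, hs.2⟩)).hasDerivAt
    obtain ⟨a, ha, n, hn, rfl⟩ := hv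
    have hag := hasDerivAt_comp_eq_inner (hA _ hn.1 ha) hxv hFd
    -- As `s > 0` is an interior time and the curve stays in `X`, `⟪n, x r⟫` has a local maximum at
    -- `r = s`.
    have hn0 : ⟪n, a - n⟫ = 0 := by
      have hd : HasDerivAt (fun r => ⟪n, x r⟫) ⟪n, a - n⟫ s := by
        simpa using (hasDerivAt_const s n).inner ℝ hxv
      refine IsLocalMax.hasDerivAt_eq_zero ?_ hd
      filter_upwards [Ioi_mem_nhds hs.1] with r hr
      have := hn.2 (x r) (hmem r (le_of_lt hr))
      rw [inner_sub_right] at this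
      linarith
    rw [hag, ← real_inner_self_eq_norm_sq, inner_neg_left]
    have := inner_sub_left (𝕜 := ℝ) a n (a - n)
    linarith
  have hderiv' := (ae_restrict_iff' measurableSet_Ioc).mpr hderiv
  have hint := hFac.integral_deriv_eq_sub
  rw [hFt, sub_self, intervalIntegral.integral_of_le ht.le] at hint
  have hzero : deriv (fun r => F (x r)) =ᵐ[volume.restrict (Ioc 0 t)] 0 := by
    have hi := hFac.intervalIntegrable_deriv
    rw [intervalIntegrable_iff_integrableOn_Ioc_of_le ht.le] at hi
    have := (integral_eq_zero_iff_of_nonneg_ae (f := fun s => -deriv (fun r => F (x r)) s)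
      (hderiv'.mono fun s hs => by
        obtain ⟨v, -, -, h⟩ := hs
        simp only [Pi.zero_apply, h, neg_neg]
        positivity) hi.neg).mp (by rw [integral_neg, hint, neg_zero])
    filter_upwards [this] with s hs
    simpa using hs
  have hvel : ∀ᵐ s ∂volume.restrict (Ioc 0 t),
      (0 : E) ∈ -A (x s) - normalCone X (x s) ∧ HasDerivAt x 0 s := by
    filter_upwards [hderiv', hzero] with s ⟨v, hv, hxv, h⟩ h0
    have hv0 : v = 0 := by
      rw [h0] at h
      simpa using h
    exact ⟨hv0 ▸ hv, hv0 ▸ hxv⟩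
  obtain ⟨c, hc⟩ := hxac.const_of_ae_hasDerivAt_zero (by
    have hne : ∀ᵐ s : ℝ, s ≠ 0 := by simp [ae_iff, measure_singleton]
    filter_upwards [(ae_restrict_iff' measurableSet_Ioc).mp hvel, hne] with s h1 h2 hs
    rw [uIcc_of_le ht.le] at hs
    exact (h1 ⟨hs.1.lt_of_ne h2.symm, hs.2⟩).2)
  rw [uIcc_of_le ht.le] at hc
  -- As `t > 0`, some time satisfies the inclusion with zero velocity; constancy of `x` carries it
  -- to every `τ`.
  have : (ae (volume.restrict (Ioc 0 t))).NeBot := by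
    rw [ae_neBot, Ne, Measure.restrict_eq_zero]
    simpa using ht
  obtain ⟨s, ⟨hs0, -⟩, hs⟩ := (hvel.and (ae_restrict_mem measurableSet_Ioc)).exists
  rw [hc τ hτ]
  rw [hc s ⟨hs.1.le, hs.2⟩] at hs0
  obtain ⟨a, ha, n, hn, han⟩ := hs0
  exact ⟨-a, ha, n, hn, by rw [← neg_eq_zero]; simpa [sub_eq_add_neg, add_comm] using han⟩

end Flow

end StochWeaklyConvex

theorem mainTheorem5 {d : ℕ} {S : Type*} [MeasurableSpace S]
    (P : Measure S) [IsProbabilityMeasure P]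
    (X : Set (EuclideanSpace ℝ (Fin d))) (hX_closed : IsClosed X) (hX_convex : Convex ℝ X)
    (f : EuclideanSpace ℝ (Fin d) → S → ℝ)
    (hf_meas : ∀ y, AEStronglyMeasurable (f y) P)
    (hf_int : ∀ y ∈ X, Integrable (f y) P)
    (hf_lip : StochWeaklyConvex.LocallyLipschitzOn X f P)
    (hf_weak : StochWeaklyConvex.LocallyWeaklyConvexOn X f P)
    (φ : EuclideanSpace ℝ (Fin d) → ℝ) (hφ : ConvexOn ℝ Set.univ φ)
    (x : ℝ → EuclideanSpace ℝ (Fin d))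
    (hx :
      StochWeaklyConvex.IsInclusionSolution
          (fun z => -StochWeaklyConvex.subgradientMap f P φ z
            - StochWeaklyConvex.normalCone X z) x ∨
        StochWeaklyConvex.IsInclusionSolution
          (fun z => -StochWeaklyConvex.integralSubgradientMap f P φ z
            - StochWeaklyConvex.normalCone X z) x)
    (t : ℝ) (ht : 0 < t)
    (hconst : StochWeaklyConvex.expected f P (x t) + φ (x t) =
      StochWeaklyConvex.expected f P (x 0) + φ (x 0)) :
    ∀ τ ∈ Set.Icc 0 t, StochWeaklyConvex.IsMinimalSubgradient f P φ X (x τ) 0 := by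
  have hF : _root_.LocallyLipschitzOn X
      (fun y => StochWeaklyConvex.expected f P y + φ y) :=
    (StochWeaklyConvex.locallyLipschitzOn_expected hf_meas hf_int hf_lip).add
      hφ.locallyLipschitz.locallyLipschitzOn
  have hsub : ∀ z, StochWeaklyConvex.subgradientMap f P φ z ⊆
      StochWeaklyConvex.frechetSubdifferential
        (fun y => StochWeaklyConvex.expected f P y + φ y) z := by
    rintro z _ ⟨u, hu, v, hv, rfl⟩
    exact StochWeaklyConvex.add_mem_frechetSubdifferential hu
      (StochWeaklyConvex.convexSubdifferential_subset_frechetSubdifferential φ z hv)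
  have hint : ∀ z ∈ X, StochWeaklyConvex.integralSubgradientMap f P φ z ⊆
      StochWeaklyConvex.subgradientMap f P φ z := fun z hz =>
    add_subset_add_right (StochWeaklyConvex.setIntegral_frechetSubdifferential_subset
      hf_meas hf_int hf_lip hf_weak hz)
  intro τ hτ
  apply StochWeaklyConvex.isMinimalNormElement_zero
  rcases hx with hx | hx
  · exact hx.zero_mem_of_eq hX_closed hF (fun z _ => hsub z) ht hconst hτ
  · obtain ⟨a, ha, n, hn, han⟩ := hx.zero_mem_of_eq hX_closed hF
      (fun z hz => (hint z hz).trans (hsub z)) ht hconst hτ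
    -- `hn.1` is the membership `x τ ∈ X` that `hint` needs.
    exact ⟨a, hint _ hn.1 ha, n, hn, han⟩
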